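/- Let $\mathbf{P}_{XY}$ be an arbitrary probability distribution on $\mathbb{R}^d\times\{0,1\}$, and let $(X,Y)$, $(X_1,Y_1),(X_2,Y_2),\dots$ be random pairs with distribution $\mathbf{P}_{XY}$ and $Z_1,Z_2,\dots$ be $\{0,1\}$-valued random variables with $\mathbf{P}\{Z_i=1\}=\tfrac12$, all of these pairs and variables being mutually independent. Let $r_n\ge 0$ be real numbers and write $B_r(x)=\{x'\in\mathbb{R}^d:\|x'-x\|\le r\}$ (Euclidean norm). For $x\in\mathbb{R}^d$ and $1\le i\le n$ put $$\delta_{ni}(x)=\begin{cases}Y_i,&\text{if }X_i\in B_{r_n}(x),\\ Z_i,&\text{otherwise,}\end{cases}\qquad g_n(x)=\begin{cases}1,&\text{if }\frac1n\sum_{i=1}^n\delta_{ni}(x)>\frac12,\\ 0,&\text{otherwise.}\end{cases}$$ Let $D_n=\{(X_i,Y_i,Z_i)\}_{i=1}^n$, let $L_n=\mathbf{P}\{g_n(X)\ne Y\mid D_n\}$, and let $L^\star=\inf_g\mathbf{P}\{g(X)\ne Y\}$ be the Bayes error, the infimum being over all measurable $g:\mathbb{R}^d\to\{0,1\}$. If,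 as $n\to\infty$, $r_n\to0$ and $r_n^d\sqrt n\to\infty$, then $\mathbf{E}\{L_n\}\to L^\star$. As $\mathbf{P}_{XY}$ is arbitrary, this says that the rule is universally consistent. -/

import Mathlib

open MeasureTheory ProbabilityTheory Filter Topology

noncomputable section

/-- The training data held by one sensor, `(X_i, Y_i, Z_i)`: a point of `ℝ^d`, a label in `{0,1}`,
and the outcome in `{0,1}` of the coin that the sensor flips when it has to guess. -/
abbrev SensorDatum (d : ℕ) : Type := EuclideanSpace ℝ (Fin d) × Fin 2 × Fin 2

/-- The bit `δ_{ni}(x)` that a sensor with datum `(X_i, Y_i, Z_i)` sends for the query `x`: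
the label `Y_i` if `X_i` lies in the ball of radius `r` about `x`, the coin flip `Z_i` otherwise. -/
def sensorDecision {d : ℕ} (r : ℝ) (s : SensorDatum d) (x : EuclideanSpace ℝ (Fin d)) : Fin 2 :=
  open Classical in if s.1 ∈ Metric.closedBall x r then s.2.1 else s.2.2

/-- The majority vote `g_n(x)` of the fusion center: `1` if `(1/n) ∑ δ_{ni}(x) > 1/2`,
and `0` otherwise. -/
def majorityVote {d n : ℕ} (r : ℝ) (D : Fin n → SensorDatum d) (x : EuclideanSpace ℝ (Fin d)) :
    Fin 2 :=
  open Classical in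
  if (1 / 2 : ℝ) < (1 / (n : ℝ)) * ∑ i, (((sensorDecision r (D i) x : Fin 2) : ℕ) : ℝ) then 1 else 0

/-- The zero-one loss on `{0,1}`. -/
def zeroOneLoss (y y' : Fin 2) : ℝ := if y ≠ y' then 1 else 0

/-- The Bayes error `L* = inf_g E l(g(X), Y)` of a distribution of `(X, Y)`; the infimum is over all
measurable decision rules `g`. -/
def bayesError {d : ℕ} (P : Measure (EuclideanSpace ℝ (Fin d) × Fin 2)) : ℝ :=
  ⨅ g : {g : EuclideanSpace ℝ (Fin d) → Fin 2 // Measurable g}, ∫ p, zeroOneLoss (g.1 p.1) p.2 ∂P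

/-- The training data `D_n` of the first `n` sensors, as a random element. -/
def trainingData {Ω : Type*} {d : ℕ} (X : ℕ → Ω → EuclideanSpace ℝ (Fin d)) (Y Z : ℕ → Ω → Fin 2)
    (n : ℕ) (ω : Ω) : Fin n → SensorDatum d :=
  fun i => (X i ω, Y i ω, Z i ω)

/-- The conditional probability of error `L_n = P{g_n(X) ≠ Y | D_n}` of the majority vote with radius
`r`, where `(X₀, Y₀)` is the observation to be classified. -/
def conditionalError {Ω : Type*} [MeasurableSpace Ω] (μ : Measure Ω) {d : ℕ}
    (X₀ : Ω → EuclideanSpace ℝ (Fin d)) (Y₀ : Ω → Fin 2)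
    (X : ℕ → Ω → EuclideanSpace ℝ (Fin d)) (Y Z : ℕ → Ω → Fin 2) (r : ℝ) (n : ℕ) : Ω → ℝ :=
  μ⟦{ω | majorityVote r (trainingData X Y Z n ω) (X₀ ω) ≠ Y₀ ω} |
    MeasurableSpace.comap (trainingData X Y Z n) inferInstance⟧

end

/-! Write η for the posterior probability and ν for the law of X. For a fixed query x the coins
average to 1/2, so each sensor votes 1 with probability 1/2 + t_n(x), where t_n(x) is the ν-integral
of η - 1/2 over the ball of radius r_n about x. The n votes are independent with variance at most
1/4, so by Chebyshev the majority misses the sign of t_n with probability at most 1/(4 n t_n²)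
(`measureReal_majorityVote_ne_le`).

It remains to see that √n |t_n| → ∞ with the sign of η(x) - 1/2, for almost every x with η(x) ≠ 1/2
(`ae_tendsto_sqrt_mul_setIntegral_closedBall`). By differentiation, t_n is asymptotic to (η(x) -
1/2) times the ν-mass of the ball. That mass is at least c r_n^d at ν-almost every x, even for
singular ν, and r_n^d √n → ∞. Where η = 1/2 both decisions cost the same. Dominated convergence then
gives the limit, the integral of min(η, 1 - η). -/

/-- The posterior probability `P(Y = 1 | X = x)` of a distribution of `(X, Y)`. -/
noncomputable def posteriorProb {E : Type*} [MeasurableSpace E] (P : Measure (E × Fin 2))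
    [IsFiniteMeasure P] (x : E) : ℝ := (P.condKernel x).real {1}

/-! ### Posterior probability and Bayes error. -/

section Posterior

variable {E : Type*} [MeasurableSpace E] (P : Measure (E × Fin 2)) [IsProbabilityMeasure P]

theorem posteriorProb_nonneg (x : E) : 0 ≤ posteriorProb P x := measureReal_nonneg

theorem posteriorProb_le_one (x : E) : posteriorProb P x ≤ 1 := measureReal_le_one

theorem condKernel_real_zero (x : E) : (P.condKernel x).real {0} = 1 - posteriorProb P x := by
  have h := probReal_compl_eq_one_sub (μ := P.condKernel x) (measurableSet_singleton (1 : Fin 2))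
  rw [posteriorProb, ← h]
  congr 1
  ext i
  fin_cases i <;> simp

theorem measurable_posteriorProb : Measurable (posteriorProb P) :=
  (P.condKernel.measurable_coe (measurableSet_singleton 1)).ennreal_toReal

theorem integrable_posteriorProb : Integrable (posteriorProb P) P.fst :=
  Integrable.of_bound (measurable_posteriorProb P).aestronglyMeasurable 1
    (.of_forall fun x => by
      rw [Real.norm_of_nonneg (posteriorProb_nonneg P x)]; exact posteriorProb_le_one P x)

theorem integral_eq_integral_posteriorProb {h : E × Fin 2 → ℝ} (hm : Measurable h) {C : ℝ}
    (hb : ∀ p, ‖h p‖ ≤ C) :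
    ∫ p, h p ∂P = ∫ x, (h (x, 0) * (1 - posteriorProb P x) + h (x, 1) * posteriorProb P x)
      ∂P.fst := by
  have hi : Integrable h (P.fst ⊗ₘ P.condKernel) :=
    Integrable.of_bound hm.aestronglyMeasurable C (.of_forall hb)
  conv_lhs => rw [← P.disintegrate P.condKernel]
  rw [Measure.integral_compProd hi]
  refine integral_congr_ae (.of_forall fun x => ?_)
  simp only
  rw [integral_fintype (Integrable.of_finite)]
  rw [Fin.sum_univ_two, condKernel_real_zero]
  simp only [posteriorProb, smul_eq_mul]
  ring

theorem zeroOneLoss_norm_le (a b : Fin 2) : ‖zeroOneLoss a b‖ ≤ 1 := by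
  unfold zeroOneLoss; split_ifs <;> simp

theorem measurable_zeroOneLoss_comp {α : Type*} [MeasurableSpace α] {f g : α → Fin 2}
    (hf : Measurable f) (hg : Measurable g) : Measurable fun a => zeroOneLoss (f a) (g a) :=
  (measurable_of_countable (fun p : Fin 2 × Fin 2 => zeroOneLoss p.1 p.2)).comp (hf.prodMk hg)

theorem integrable_min_posteriorProb :
    Integrable (fun x => min (posteriorProb P x) (1 - posteriorProb P x)) P.fst :=
  (integrable_posteriorProb P).inf ((integrable_const 1).sub (integrable_posteriorProb P))

theorem integral_zeroOneLoss_eq {g : E → Fin 2} (hg : Measurable g) :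
    ∫ p, zeroOneLoss (g p.1) p.2 ∂P =
      ∫ x, (if g x = 1 then 1 - posteriorProb P x else posteriorProb P x) ∂P.fst := by
  rw [integral_eq_integral_posteriorProb P
    (measurable_zeroOneLoss_comp (f := fun p : E × Fin 2 => g p.1) (hg.comp measurable_fst)
      measurable_snd)
    (fun p => zeroOneLoss_norm_le _ _)]
  refine integral_congr_ae (.of_forall fun x => ?_)
  have : g x = 0 ∨ g x = 1 := by omega
  rcases this with h | h <;> simp [h, zeroOneLoss]

end Posterior

/-- At each x a rule pays either η or 1 - η, so the minimum bounds every risk from below; the rule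
1_{η > 1/2} attains it. -/
theorem bayesError_eq_integral_min {d : ℕ} (P : Measure (EuclideanSpace ℝ (Fin d) × Fin 2))
    [IsProbabilityMeasure P] :
    bayesError P = ∫ x, min (posteriorProb P x) (1 - posteriorProb P x) ∂P.fst := by
  classical
  have hle : ∀ g : {g : EuclideanSpace ℝ (Fin d) → Fin 2 // Measurable g},
      ∫ x, min (posteriorProb P x) (1 - posteriorProb P x) ∂P.fst ≤
        ∫ p, zeroOneLoss (g.1 p.1) p.2 ∂P := by
    intro g
    rw [integral_zeroOneLoss_eq P g.2]
    refine integral_mono (integrable_min_posteriorProb P) ?_ fun x => ?_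
    · refine Integrable.of_bound (Measurable.aestronglyMeasurable ?_) 1 (.of_forall fun x => ?_)
      · exact Measurable.ite (g.2 (measurableSet_singleton 1))
          (measurable_const.sub (measurable_posteriorProb P)) (measurable_posteriorProb P)
      · have h0 := posteriorProb_nonneg P x
        have h1 := posteriorProb_le_one P x
        rw [Real.norm_eq_abs, abs_le]
        split_ifs <;> constructor <;> linarith
    · dsimp only
      split_ifs
      · exact min_le_right _ _
      · exact min_le_left _ _
  have : Nonempty {g : EuclideanSpace ℝ (Fin d) → Fin 2 // Measurable g} :=
    ⟨⟨fun _ => 0, measurable_const⟩⟩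
  refine le_antisymm ?_ (le_ciInf hle)
  have hg : Measurable fun x => if 1 / 2 < posteriorProb P x then (1 : Fin 2) else 0 :=
    Measurable.ite (measurableSet_lt measurable_const (measurable_posteriorProb P))
      measurable_const measurable_const
  refine (ciInf_le ⟨_, Set.forall_mem_range.2 hle⟩ ⟨_, hg⟩).trans_eq ?_
  rw [integral_zeroOneLoss_eq P hg]
  refine integral_congr_ae (.of_forall fun x => ?_)
  by_cases h : 1 / 2 < posteriorProb P x
  · simp only [h, if_true]
    rw [min_eq_right (by linarith)]
  · simp only [h, if_false]
    rw [min_eq_left (by linarith)]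
    simp

/-! ### Mass of small balls and differentiation of measures. -/

section Differentiation

variable {d : ℕ} (ν : Measure (EuclideanSpace ℝ (Fin d))) [IsFiniteMeasure ν]

/-- Almost every point of a finite measure has positive lower density with respect to volume. -/
theorem ae_exists_mul_pow_le_measureReal_closedBall :
    ∀ᵐ x ∂ν, ∃ c > 0, ∀ᶠ ρ in 𝓝[>] (0 : ℝ), c * ρ ^ d ≤ ν.real (Metric.closedBall x ρ) := by
  -- Volume is differentiated with respect to `ν`, not conversely: this derivative is finite
  -- `ν`-a.e. whatever `ν` is, so vol(B)/ν(B) stays below some `K` on small balls.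
  filter_upwards [Besicovitch.ae_tendsto_rnDeriv (volume : Measure (EuclideanSpace ℝ (Fin d))) ν,
    Measure.rnDeriv_lt_top (volume : Measure (EuclideanSpace ℝ (Fin d))) ν] with x hx hfin
  obtain ⟨K, hK⟩ := ENNReal.lt_iff_exists_nnreal_btwn.1 hfin
  have hK0 : 0 < K := by
    have := zero_le.trans_lt hK.1
    exact_mod_cast this
  set v : ℝ := (volume : Measure (EuclideanSpace ℝ (Fin d))).real (Metric.ball 0 1) with hv
  have hv0 : 0 < v := ENNReal.toReal_pos (Metric.measure_ball_pos _ _ one_pos).ne'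
    measure_ball_lt_top.ne
  refine ⟨v / K, by positivity, ?_⟩
  filter_upwards [hx.eventually_le_const hK.1, self_mem_nhdsWithin] with ρ hρ hρ0
  have hρ0' : 0 < ρ := hρ0
  rw [ENNReal.div_le_iff_le_mul (.inr (ENNReal.coe_ne_top)) (.inr (by exact_mod_cast hK0.ne'))] at hρ
  have h := ENNReal.toReal_mono (ENNReal.mul_ne_top ENNReal.coe_ne_top (measure_ne_top _ _)) hρ
  rw [Measure.addHaar_closedBall _ _ hρ0'.le, ENNReal.toReal_mul, ENNReal.toReal_mul,
    ENNReal.toReal_ofReal (by positivity), finrank_euclideanSpace_fin] at h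
  have h' : ρ ^ d * v ≤ K * ν.real (Metric.closedBall x ρ) := h
  rw [div_mul_eq_mul_div, div_le_iff₀ (by exact_mod_cast hK0)]
  linarith

/-- The integral is the mass of the ball, at least a multiple of `r n ^ d`, times the average of
`f`, which tends to `f x > 0` almost everywhere. -/
theorem ae_tendsto_sqrt_mul_setIntegral_closedBall_of_pos {f : EuclideanSpace ℝ (Fin d) → ℝ}
    (hf : Integrable f ν) {r : ℕ → ℝ} (hr_pos : ∀ᶠ n in atTop, 0 < r n)
    (hr_zero : Tendsto r atTop (𝓝 0))
    (hr_slow : Tendsto (fun n : ℕ => r n ^ d * Real.sqrt (n : ℝ)) atTop atTop) :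
    ∀ᵐ x ∂ν, 0 < f x →
      Tendsto (fun n : ℕ => Real.sqrt n * ∫ y in Metric.closedBall x (r n), f y ∂ν) atTop atTop := by
  have hr : Tendsto r atTop (𝓝[>] 0) := tendsto_nhdsWithin_iff.2 ⟨hr_zero, hr_pos⟩
  filter_upwards [ae_exists_mul_pow_le_measureReal_closedBall ν,
    (Besicovitch.vitaliFamily ν).ae_tendsto_average hf.locallyIntegrable] with x ⟨c, hc, hcx⟩ hx hfx
  have havg := (hx.comp (Besicovitch.tendsto_filterAt ν x)).comp hr
  have hlarge : Tendsto (fun n : ℕ => Real.sqrt n * ν.real (Metric.closedBall x (r n)))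
      atTop atTop := by
    refine tendsto_atTop_mono' _ ?_ (hr_slow.const_mul_atTop hc)
    filter_upwards [hr.eventually hcx] with n hn
    have := mul_le_mul_of_nonneg_left hn (Real.sqrt_nonneg (n : ℝ))
    linarith
  refine (hlarge.atTop_mul_pos hfx havg).congr fun n => ?_
  have := measure_smul_setAverage (μ := ν) f (measure_ne_top ν (Metric.closedBall x (r n)))
  simp only [Function.comp_apply]
  rw [← this, smul_eq_mul, mul_assoc]

/-- For `f` integrable, `√n` times the integral of `f` over the ball of radius `r n` diverges to
`+∞` at almost every point where `f` is positive, if `r n` does not decay too fast. -/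
theorem ae_tendsto_sqrt_mul_setIntegral_closedBall {f : EuclideanSpace ℝ (Fin d) → ℝ}
    (hf : Integrable f ν) {r : ℕ → ℝ} (hr_nonneg : ∀ n, 0 ≤ r n)
    (hr_zero : Tendsto r atTop (𝓝 0))
    (hr_slow : Tendsto (fun n : ℕ => r n ^ d * Real.sqrt (n : ℝ)) atTop atTop) :
    ∀ᵐ x ∂ν, 0 < f x →
      Tendsto (fun n : ℕ => Real.sqrt n * ∫ y in Metric.closedBall x (r n), f y ∂ν) atTop atTop := by
  -- In dimension 0 the radii may vanish, but every ball is the whole space, so 1/(n+1) can replace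
  -- them. Otherwise `hr_slow` forces `r n` to be eventually positive.
  rcases Nat.eq_zero_or_pos d with rfl | hd
  · have h := ae_tendsto_sqrt_mul_setIntegral_closedBall_of_pos ν hf
      (r := fun n : ℕ => 1 / ((n : ℝ) + 1)) (.of_forall fun n => by positivity)
      tendsto_one_div_add_atTop_nhds_zero_nat (by simpa using hr_slow)
    have hball : ∀ (x : EuclideanSpace ℝ (Fin 0)) {ρ : ℝ}, 0 ≤ ρ →
        Metric.closedBall x ρ = Set.univ := fun x ρ hρ =>
      Set.eq_univ_of_forall fun y => by simpa [Subsingleton.elim y x] using hρ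
    filter_upwards [h] with x hx hfx
    refine (hx hfx).congr fun n => ?_
    rw [hball x (hr_nonneg n), hball x (by positivity)]
  · refine ae_tendsto_sqrt_mul_setIntegral_closedBall_of_pos ν hf ?_ hr_zero hr_slow
    filter_upwards [hr_slow.eventually_gt_atTop 0] with n hn
    refine (hr_nonneg n).lt_of_ne fun h => ?_
    simp [← h, hd.ne'] at hn

end Differentiation

/-! ### Chebyshev bound for a majority of independent votes. -/

section Chebyshev

variable {Ω : Type*} [MeasurableSpace Ω] {μ : Measure Ω} [IsProbabilityMeasure μ]

/-- Chebyshev's inequality for a sum of `n` independent variables in `[0, 1]` with mean `m`. -/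
theorem measureReal_le_abs_sum_sub_le {n : ℕ} {V : Fin n → Ω → ℝ} (hV : ∀ i, Measurable (V i))
    (hV01 : ∀ i ω, V i ω ∈ Set.Icc (0 : ℝ) 1) (hindep : Pairwise fun i j => V i ⟂ᵢ[μ] V j)
    {m : ℝ} (hm : ∀ i, ∫ ω, V i ω ∂μ = m) {c : ℝ} (hc : 0 < c) :
    μ.real {ω | c ≤ |∑ i, V i ω - n * m|} ≤ n / (4 * c ^ 2) := by
  have hL : ∀ i, MemLp (V i) 2 μ := fun i =>
    MemLp.of_bound (hV i).aestronglyMeasurable 1 (.of_forall fun ω => by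
      rw [Real.norm_of_nonneg (hV01 i ω).1]; exact (hV01 i ω).2)
  have hmean : μ[∑ i, V i] = n * m := by
    simp only [Finset.sum_apply]
    rw [integral_finsetSum _ fun i _ => (hL i).integrable (by norm_num)]
    simp [hm]
  have hvar : variance (∑ i, V i) μ ≤ n / 4 := by
    rw [IndepFun.variance_sum (fun i _ => hL i) (fun i _ j _ hij => hindep hij)]
    calc ∑ i, variance (V i) μ ≤ ∑ _i : Fin n, (1 / 4 : ℝ) := by
          refine Finset.sum_le_sum fun i _ => ?_
          refine (variance_le_sq_of_bounded (.of_forall (hV01 i)) (hV i).aemeasurable).trans ?_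
          norm_num
      _ = n / 4 := by simp; ring
  have h := meas_ge_le_variance_div_sq (memLp_finsetSum' Finset.univ fun i _ => hL i) hc
  rw [hmean] at h
  simp only [Finset.sum_apply] at h
  have h2 := ENNReal.toReal_mono ENNReal.ofReal_ne_top h
  rw [ENNReal.toReal_ofReal (div_nonneg (variance_nonneg _ _) (sq_nonneg c))] at h2
  refine h2.trans ?_
  rw [← div_div]
  gcongr

/-- A majority on the wrong side of 1/2 forces the sum to deviate from `n * m` by at least `n * |m -
1/2|`. -/
theorem measureReal_majority_ne_le {n : ℕ} (hn : 0 < n) {V : Fin n → Ω → ℝ}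
    (hV : ∀ i, Measurable (V i)) (hV01 : ∀ i ω, V i ω ∈ Set.Icc (0 : ℝ) 1)
    (hindep : Pairwise fun i j => V i ⟂ᵢ[μ] V j) {m : ℝ} (hm : ∀ i, ∫ ω, V i ω ∂μ = m)
    (hm2 : m ≠ 1 / 2) :
    μ.real {ω | ¬ (1 / 2 < 1 / (n : ℝ) * ∑ i, V i ω ↔ 1 / 2 < m)} ≤
      ((2 * (Real.sqrt n * (m - 1 / 2))) ^ 2)⁻¹ := by
  have hn' : (0 : ℝ) < n := by exact_mod_cast hn
  have habs : 0 < |m - 1 / 2| := abs_pos.2 (sub_ne_zero.2 hm2)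
  have h := measureReal_le_abs_sum_sub_le (μ := μ) hV hV01 hindep hm (mul_pos hn' habs)
  refine (measureReal_mono (fun ω hω => ?_)).trans (h.trans_eq ?_)
  · simp only [Set.mem_ofPred_eq] at hω ⊢
    set S := ∑ i, V i ω
    rw [one_div_mul_eq_div, lt_div_iff₀ hn'] at hω
    rcases lt_or_gt_of_ne hm2 with hlt | hgt
    · have hS : 1 / 2 * n < S := by
        by_contra hS
        exact hω ⟨fun h => absurd h hS, fun h => absurd h hlt.le.not_gt⟩
      rw [abs_of_neg (by linarith)]
      exact le_trans (by nlinarith) (le_abs_self _)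
    · have hS : ¬ 1 / 2 * n < S := fun hS => hω ⟨fun _ => hgt, fun _ => hS⟩
      rw [abs_of_pos (by linarith)]
      exact le_trans (by nlinarith) (neg_abs_le _ |> neg_le.1)
  · rw [mul_pow, mul_pow, mul_pow, sq_abs, Real.sq_sqrt hn'.le]
    have : m - 1 / 2 ≠ 0 := sub_ne_zero.2 hm2
    field_simp
    norm_num

end Chebyshev

/-! ### Measurability and mean of a single vote. -/

section Votes

variable {d : ℕ}

theorem measurable_sensorDecision {α : Type*} [MeasurableSpace α] (ρ : ℝ)
    {s : α → SensorDatum d} {x : α → EuclideanSpace ℝ (Fin d)} (hs : Measurable s)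
    (hx : Measurable x) : Measurable fun a => sensorDecision ρ (s a) (x a) := by
  classical
  unfold sensorDecision
  refine Measurable.ite ?_ (measurable_fst.comp (measurable_snd.comp hs))
    (measurable_snd.comp (measurable_snd.comp hs))
  exact measurableSet_le ((measurable_fst.comp hs).dist hx) measurable_const

theorem measurable_natCast_fin_two : Measurable fun a : Fin 2 => (((a : Fin 2) : ℕ) : ℝ) :=
  measurable_of_countable _

theorem measurable_majorityVote {α : Type*} [MeasurableSpace α] (ρ : ℝ) {n : ℕ}
    {D : α → Fin n → SensorDatum d} {x : α → EuclideanSpace ℝ (Fin d)} (hD : Measurable D)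
    (hx : Measurable x) : Measurable fun a => majorityVote ρ (D a) (x a) := by
  classical
  have hsum : Measurable fun a =>
      (1 / (n : ℝ)) * ∑ i, (((sensorDecision ρ (D a i) (x a) : Fin 2) : ℕ) : ℝ) := by
    refine measurable_const.mul (Finset.measurable_fun_sum _ fun i _ => ?_)
    have hdec := measurable_sensorDecision ρ (measurable_pi_iff.1 hD i) hx
    exact measurable_natCast_fin_two.comp hdec
  unfold majorityVote
  exact Measurable.ite (measurableSet_lt measurable_const hsum) measurable_const measurable_const

theorem natCast_fin_two_mem_Icc (a : Fin 2) : (((a : Fin 2) : ℕ) : ℝ) ∈ Set.Icc (0 : ℝ) 1 := by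
  fin_cases a <;> simp

theorem integral_natCast_coin {Ω : Type*} [MeasurableSpace Ω] {μ : Measure Ω} {Z : Ω → Fin 2} (hZ : Measurable Z)
    (hcoin : μ {ω | Z ω = 1} = 1 / 2) : ∫ ω, (((Z ω : Fin 2) : ℕ) : ℝ) ∂μ = 1 / 2 := by
  have h : (fun ω => (((Z ω : Fin 2) : ℕ) : ℝ)) = {ω | Z ω = 1}.indicator 1 := by
    ext ω
    have : Z ω = 0 ∨ Z ω = 1 := by omega
    rcases this with h | h <;> simp [h]
  rw [h, integral_indicator_one (s := {ω | Z ω = 1}) (hZ (measurableSet_singleton 1)),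
    measureReal_def, hcoin]
  simp

variable (P : Measure (EuclideanSpace ℝ (Fin d) × Fin 2)) [IsProbabilityMeasure P]
  {Ω : Type*} [MeasurableSpace Ω] {μ : Measure Ω} [IsProbabilityMeasure μ]

/-- The probability that a sensor votes `1` for the query `x`. -/
theorem integral_sensorDecision {X : Ω → EuclideanSpace ℝ (Fin d)} {Y Z : Ω → Fin 2}
    (hX : Measurable X) (hY : Measurable Y) (hZ : Measurable Z)
    (hlaw : μ.map (fun ω => (X ω, Y ω)) = P) (hcoin : μ {ω | Z ω = 1} = 1 / 2)
    (hindep : IndepFun (fun ω => (X ω, Y ω)) Z μ) (ρ : ℝ) (x : EuclideanSpace ℝ (Fin d)) :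
    ∫ ω, (((sensorDecision ρ (X ω, Y ω, Z ω) x : Fin 2) : ℕ) : ℝ) ∂μ =
      1 / 2 + ∫ y in Metric.closedBall x ρ, (posteriorProb P y - 1 / 2) ∂P.fst := by
  classical
  set S := Metric.closedBall x ρ
  have hS : MeasurableSet S := Metric.isClosed_closedBall.measurableSet
  -- The vote is `a (X, Y) + b (X, Y) * Z`; independence of the coin lets its mean 1/2 replace `Z`.
  set a : EuclideanSpace ℝ (Fin d) × Fin 2 → ℝ :=
    fun p => S.indicator 1 p.1 * (((p.2 : Fin 2) : ℕ) : ℝ) with ha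
  set b : EuclideanSpace ℝ (Fin d) × Fin 2 → ℝ := fun p => 1 - S.indicator 1 p.1 with hb
  have hind : Measurable (S.indicator (1 : EuclideanSpace ℝ (Fin d) → ℝ)) :=
    measurable_const.indicator hS
  have hind01 : ∀ y, S.indicator (1 : EuclideanSpace ℝ (Fin d) → ℝ) y ∈ Set.Icc (0 : ℝ) 1 := by
    intro y; by_cases hy : y ∈ S <;> simp [hy]
  have ham : Measurable a :=
    (hind.comp measurable_fst).mul (measurable_natCast_fin_two.comp measurable_snd)
  have hbm : Measurable b := measurable_const.sub (hind.comp measurable_fst)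
  have hab : ∀ p, ‖a p‖ ≤ 1 := fun p => by
    have h1 := hind01 p.1
    have h2 := natCast_fin_two_mem_Icc p.2
    rw [Real.norm_of_nonneg (mul_nonneg h1.1 h2.1)]
    exact mul_le_one₀ h1.2 h2.1 h2.2
  have hbb : ∀ p, ‖b p‖ ≤ 1 := fun p => by
    have h1 := hind01 p.1
    rw [Real.norm_of_nonneg (sub_nonneg.2 h1.2)]
    exact sub_le_self _ h1.1
  have hXY : Measurable fun ω => (X ω, Y ω) := hX.prodMk hY
  have hZm : Measurable fun ω => (((Z ω : Fin 2) : ℕ) : ℝ) := measurable_natCast_fin_two.comp hZ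
  have hdec : ∀ ω, (((sensorDecision ρ (X ω, Y ω, Z ω) x : Fin 2) : ℕ) : ℝ) =
      a (X ω, Y ω) + b (X ω, Y ω) * (((Z ω : Fin 2) : ℕ) : ℝ) := by
    intro ω
    by_cases h : X ω ∈ S
    · simp [sensorDecision, ha, hb, h, show X ω ∈ Metric.closedBall x ρ from h, -Metric.mem_closedBall]
    · simp [sensorDecision, ha, hb, h, show X ω ∉ Metric.closedBall x ρ from h, -Metric.mem_closedBall]
  have hai : Integrable (fun ω => a (X ω, Y ω)) μ :=
    Integrable.of_bound (ham.comp hXY).aestronglyMeasurable 1 (.of_forall fun ω => hab _)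
  have hbz : Integrable (fun ω => b (X ω, Y ω) * (((Z ω : Fin 2) : ℕ) : ℝ)) μ := by
    refine Integrable.of_bound ((hbm.comp hXY).mul hZm).aestronglyMeasurable 1
      (.of_forall fun ω => ?_)
    have h2 := natCast_fin_two_mem_Icc (Z ω)
    rw [norm_mul, Real.norm_of_nonneg h2.1]
    exact mul_le_one₀ (hbb _) h2.1 h2.2
  have hprod : ∫ ω, b (X ω, Y ω) * (((Z ω : Fin 2) : ℕ) : ℝ) ∂μ =
      (∫ ω, b (X ω, Y ω) ∂μ) * (1 / 2) := by
    rw [← integral_natCast_coin hZ hcoin]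
    exact (hindep.comp hbm measurable_natCast_fin_two).integral_mul_eq_mul_integral
      (hbm.comp hXY).aestronglyMeasurable hZm.aestronglyMeasurable
  have hbi : Integrable (fun ω => b (X ω, Y ω) * (1 / 2)) μ :=
    (Integrable.of_bound (hbm.comp hXY).aestronglyMeasurable 1
      (.of_forall fun ω => hbb _)).mul_const _
  simp_rw [hdec]
  rw [integral_add hai hbz, hprod, ← integral_mul_const, ← integral_add hai hbi]
  have hmap : ∫ p, (a p + b p * (1 / 2)) ∂P =
      ∫ ω, (a (X ω, Y ω) + b (X ω, Y ω) * (1 / 2)) ∂μ := by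
    rw [← hlaw]
    exact integral_map hXY.aemeasurable (ham.add (hbm.mul_const _)).aestronglyMeasurable
  rw [← hmap, integral_eq_integral_posteriorProb P (h := fun p => a p + b p * (1 / 2))
    (ham.add (hbm.mul_const _)) (C := 2)]
  · have hint : Integrable (fun y => posteriorProb P y - 1 / 2) P.fst :=
      (integrable_posteriorProb P).sub (integrable_const _)
    rw [← integral_indicator hS]
    have hhalf : ∫ _ : EuclideanSpace ℝ (Fin d), (1 / 2 : ℝ) ∂P.fst = 1 / 2 := by simp
    refine Eq.trans ?_ ((integral_add (integrable_const (1 / 2 : ℝ)) (hint.indicator hS)).trans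
      (by rw [hhalf]))
    refine integral_congr_ae (.of_forall fun y => ?_)
    by_cases h : y ∈ S
    · simp [ha, hb, h]
    · simp [ha, hb, h]
      ring
  · intro p
    refine (norm_add_le (a p) (b p * (1 / 2))).trans ?_
    rw [norm_mul (b p), Real.norm_of_nonneg (by norm_num : (0 : ℝ) ≤ 1 / 2)]
    linarith [hab p, hbb p]

end Votes

/-! ### Error probability of the fused decision. -/

section Consistency

variable {d : ℕ} (P : Measure (EuclideanSpace ℝ (Fin d) × Fin 2)) [IsProbabilityMeasure P]
  {Ω : Type*} [MeasurableSpace Ω] {μ : Measure Ω} [IsProbabilityMeasure μ]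
  {X : ℕ → Ω → EuclideanSpace ℝ (Fin d)} {Y Z : ℕ → Ω → Fin 2}

theorem majorityVote_eq_one_iff {n : ℕ} (ρ : ℝ) (D : Fin n → SensorDatum d)
    (x : EuclideanSpace ℝ (Fin d)) :
    majorityVote ρ D x = 1 ↔
      1 / 2 < 1 / (n : ℝ) * ∑ i, (((sensorDecision ρ (D i) x : Fin 2) : ℕ) : ℝ) := by
  unfold majorityVote
  split_ifs with h
  · exact iff_of_true rfl h
  · exact iff_of_false zero_ne_one h

theorem measurable_sensorDatum (hX : ∀ i, Measurable (X i)) (hY : ∀ i, Measurable (Y i))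
    (hZ : ∀ i, Measurable (Z i)) (i : ℕ) :
    Measurable fun ω => ((X i ω, Y i ω, Z i ω) : SensorDatum d) :=
  (hX i).prodMk ((hY i).prodMk (hZ i))

theorem measurable_trainingData (hX : ∀ i, Measurable (X i)) (hY : ∀ i, Measurable (Y i))
    (hZ : ∀ i, Measurable (Z i)) (n : ℕ) : Measurable (trainingData X Y Z n) :=
  measurable_pi_lambda _ fun i => measurable_sensorDatum hX hY hZ i

theorem measurableSet_majorityVote_eq_one (hX : ∀ i, Measurable (X i))
    (hY : ∀ i, Measurable (Y i)) (hZ : ∀ i, Measurable (Z i)) (ρ : ℝ) (n : ℕ)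
    (x : EuclideanSpace ℝ (Fin d)) :
    MeasurableSet {ω | majorityVote ρ (trainingData X Y Z n ω) x = 1} := by
  have h : Measurable fun ω => majorityVote ρ (trainingData X Y Z n ω) x :=
    measurable_majorityVote ρ (measurable_trainingData hX hY hZ n) measurable_const
  exact h (measurableSet_singleton 1)

/-- The probability that the fusion center decides differently from its limit `1_{m > 1/2}`, where
`m - 1/2` is the integral of `η - 1/2` over the ball. -/
theorem measureReal_majorityVote_ne_le
    (hX : ∀ i, Measurable (X i)) (hY : ∀ i, Measurable (Y i)) (hZ : ∀ i, Measurable (Z i))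
    (hlaw : ∀ i, μ.map (fun ω => (X i ω, Y i ω)) = P)
    (hcoin : ∀ i, μ {ω | Z i ω = 1} = 1 / 2)
    (hindep_coin : ∀ i, IndepFun (fun ω => (X i ω, Y i ω)) (Z i) μ)
    (hindep_sensors : iIndepFun (fun (i : ℕ) (ω : Ω) => (X i ω, Y i ω, Z i ω)) μ)
    (ρ : ℝ) {n : ℕ} (hn : 0 < n) (x : EuclideanSpace ℝ (Fin d)) {t : ℝ}
    (ht : t = ∫ y in Metric.closedBall x ρ, (posteriorProb P y - 1 / 2) ∂P.fst) (ht0 : t ≠ 0) :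
    μ.real {ω | ¬ (majorityVote ρ (trainingData X Y Z n ω) x = 1 ↔ 0 < t)} ≤
      ((2 * (Real.sqrt n * t)) ^ 2)⁻¹ := by
  have hg : Measurable fun s : SensorDatum d => (((sensorDecision ρ s x : Fin 2) : ℕ) : ℝ) :=
    measurable_natCast_fin_two.comp (measurable_sensorDecision ρ measurable_id measurable_const)
  have h := measureReal_majority_ne_le (μ := μ) hn
    (V := fun (i : Fin n) ω => (((sensorDecision ρ (X i ω, Y i ω, Z i ω) x : Fin 2) : ℕ) : ℝ))
    (fun i => hg.comp (measurable_sensorDatum hX hY hZ i)) (fun i ω => natCast_fin_two_mem_Icc _)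
    (fun i j hij => (hindep_sensors.indepFun (fun h => hij (Fin.ext h))).comp hg hg)
    (m := 1 / 2 + t)
    (fun i => by
      rw [ht]
      exact integral_sensorDecision P (hX i) (hY i) (hZ i) (hlaw i) (hcoin i) (hindep_coin i) ρ x)
    (fun h => ht0 (by linarith))
  simpa only [majorityVote_eq_one_iff, trainingData, lt_add_iff_pos_right, add_sub_cancel_left]
    using h

/-- The error probability of the majority vote, as an integral over the query point. -/
theorem integral_conditionalError {X₀ : Ω → EuclideanSpace ℝ (Fin d)} {Y₀ : Ω → Fin 2}
    (hX₀ : Measurable X₀) (hY₀ : Measurable Y₀)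
    (hX : ∀ i, Measurable (X i)) (hY : ∀ i, Measurable (Y i)) (hZ : ∀ i, Measurable (Z i))
    (hlaw₀ : μ.map (fun ω => (X₀ ω, Y₀ ω)) = P)
    (hindep_obs : IndepFun (fun ω => (X₀ ω, Y₀ ω))
      (fun (ω : Ω) (i : ℕ) => (X i ω, Y i ω, Z i ω)) μ) (ρ : ℝ) (n : ℕ) :
    ∫ ω, conditionalError μ X₀ Y₀ X Y Z ρ n ω ∂μ =
      ∫ x, (μ.real {ω | majorityVote ρ (trainingData X Y Z n ω) x = 1} * (1 - posteriorProb P x) +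
        (1 - μ.real {ω | majorityVote ρ (trainingData X Y Z n ω) x = 1}) * posteriorProb P x)
        ∂P.fst := by
  have hD := measurable_trainingData hX hY hZ n
  have hobs : Measurable fun ω => (X₀ ω, Y₀ ω) := hX₀.prodMk hY₀
  set A : Set ((EuclideanSpace ℝ (Fin d) × Fin 2) × (Fin n → SensorDatum d)) :=
    {q | majorityVote ρ q.2 q.1.1 ≠ q.1.2} with hA
  have hAm : MeasurableSet A := by
    have hv : Measurable fun q : (EuclideanSpace ℝ (Fin d) × Fin 2) × (Fin n → SensorDatum d) =>
        majorityVote ρ q.2 q.1.1 :=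
      measurable_majorityVote ρ measurable_snd (measurable_fst.comp measurable_fst)
    exact (measurableSet_eq_fun hv (measurable_snd.comp measurable_fst)).compl
  have hpre : MeasurableSet {ω | majorityVote ρ (trainingData X Y Z n ω) (X₀ ω) ≠ Y₀ ω} :=
    (hobs.prodMk hD) hAm
  -- Independence makes the joint law a product, so the error can be computed by fixing the query
  -- and averaging over the data.
  have hjoint : μ.map (fun ω => ((X₀ ω, Y₀ ω), trainingData X Y Z n ω)) =
      P.prod (μ.map (trainingData X Y Z n)) := by
    have hrestr : Measurable fun (s : ℕ → SensorDatum d) (i : Fin n) => s i :=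
      measurable_pi_lambda _ fun i => measurable_pi_apply _
    have hind : IndepFun (fun ω => (X₀ ω, Y₀ ω)) (trainingData X Y Z n) μ :=
      hindep_obs.comp measurable_id hrestr
    rw [(indepFun_iff_map_prod_eq_prod_map_map hobs.aemeasurable hD.aemeasurable).1 hind, hlaw₀]
  have : IsProbabilityMeasure (μ.map (trainingData X Y Z n)) :=
    Measure.isProbabilityMeasure_map hD.aemeasurable
  have hsec : ∀ p, (μ.map (trainingData X Y Z n)).real (Prod.mk p ⁻¹' A) =
      μ.real {ω | majorityVote ρ (trainingData X Y Z n ω) p.1 ≠ p.2} := fun p => by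
    rw [map_measureReal_apply hD (measurable_prodMk_left hAm)]
    rfl
  have hmeas : Measurable fun p => (μ.map (trainingData X Y Z n)).real (Prod.mk p ⁻¹' A) :=
    (measurable_measure_prodMk_left hAm).ennreal_toReal
  have herr : ∫ ω, conditionalError μ X₀ Y₀ X Y Z ρ n ω ∂μ =
      ∫ p, (μ.map (trainingData X Y Z n)).real (Prod.mk p ⁻¹' A) ∂P := by
    unfold conditionalError
    rw [integral_condExp_indicator hD hpre]
    have h1 : μ.real {ω | majorityVote ρ (trainingData X Y Z n ω) (X₀ ω) ≠ Y₀ ω} =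
        (P.prod (μ.map (trainingData X Y Z n))).real A := by
      rw [← hjoint, map_measureReal_apply (hobs.prodMk hD) hAm]
      rfl
    rw [h1, measureReal_def, Measure.prod_apply hAm]
    exact (integral_toReal (measurable_measure_prodMk_left hAm).aemeasurable
      (.of_forall fun _ => measure_lt_top _ _)).symm
  rw [herr, integral_eq_integral_posteriorProb P hmeas (C := 1) fun p => by
    rw [Real.norm_of_nonneg measureReal_nonneg]; exact measureReal_le_one]
  refine integral_congr_ae (.of_forall fun x => ?_)
  have hone := measurableSet_majorityVote_eq_one hX hY hZ ρ n x
  have h0 : {ω | majorityVote ρ (trainingData X Y Z n ω) x ≠ 0} =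
      {ω | majorityVote ρ (trainingData X Y Z n ω) x = 1} := by
    ext ω
    simp only [Set.mem_ofPred_eq]
    omega
  have h1 : {ω | majorityVote ρ (trainingData X Y Z n ω) x ≠ 1} =
      {ω | majorityVote ρ (trainingData X Y Z n ω) x = 1}ᶜ := rfl
  simp only [hsec]
  rw [h0, h1, probReal_compl_eq_one_sub hone]

end Consistency

/-! ### Universal consistency. -/

theorem proposition1 {d : ℕ} (r : ℕ → ℝ) (hr_nonneg : ∀ n, 0 ≤ r n)
    (hr_zero : Tendsto r atTop (𝓝 0))
    (hr_slow : Tendsto (fun n : ℕ => r n ^ d * Real.sqrt (n : ℝ)) atTop atTop)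
    -- an arbitrary distribution of `(X, Y)`
    (P : Measure (EuclideanSpace ℝ (Fin d) × Fin 2)) [IsProbabilityMeasure P]
    {Ω : Type*} [MeasurableSpace Ω] (μ : Measure Ω) [IsProbabilityMeasure μ]
    -- the observation to be classified, the training data and the coins of the sensors
    (X₀ : Ω → EuclideanSpace ℝ (Fin d)) (Y₀ : Ω → Fin 2)
    (X : ℕ → Ω → EuclideanSpace ℝ (Fin d)) (Y Z : ℕ → Ω → Fin 2)
    (hX₀ : Measurable X₀) (hY₀ : Measurable Y₀)
    (hX : ∀ i, Measurable (X i)) (hY : ∀ i, Measurable (Y i)) (hZ : ∀ i, Measurable (Z i))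
    -- the distributions of these variables
    (hlaw₀ : μ.map (fun ω => (X₀ ω, Y₀ ω)) = P)
    (hlaw : ∀ i, μ.map (fun ω => (X i ω, Y i ω)) = P)
    (hcoin : ∀ i, μ {ω | Z i ω = 1} = 1 / 2)
    -- mutual independence of `(X₀, Y₀)`, of all the `(X i, Y i)` and of all the `Z i`
    (hindep_coin : ∀ i, IndepFun (fun ω => (X i ω, Y i ω)) (Z i) μ)
    (hindep_sensors : iIndepFun (fun (i : ℕ) (ω : Ω) => (X i ω, Y i ω, Z i ω)) μ)
    (hindep_obs : IndepFun (fun ω => (X₀ ω, Y₀ ω))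
      (fun (ω : Ω) (i : ℕ) => (X i ω, Y i ω, Z i ω)) μ) :
    Tendsto (fun n : ℕ => ∫ ω, conditionalError μ X₀ Y₀ X Y Z (r n) n ω ∂μ) atTop
      (𝓝 (bayesError P)) := by
  simp only [integral_conditionalError P hX₀ hY₀ hX hY hZ hlaw₀ hindep_obs]
  rw [bayesError_eq_integral_min]
  set q : ℕ → EuclideanSpace ℝ (Fin d) → ℝ :=
    fun n x => μ.real {ω | majorityVote (r n) (trainingData X Y Z n ω) x = 1} with hq
  have hqm : ∀ n, Measurable (q n) := by
    intro n
    have hset : MeasurableSet {p : EuclideanSpace ℝ (Fin d) × Ω |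
        majorityVote (r n) (trainingData X Y Z n p.2) p.1 = 1} := by
      have hv : Measurable fun p : EuclideanSpace ℝ (Fin d) × Ω =>
          majorityVote (r n) (trainingData X Y Z n p.2) p.1 :=
        measurable_majorityVote (r n)
          ((measurable_trainingData hX hY hZ n).comp measurable_snd) measurable_fst
      exact hv (measurableSet_singleton 1)
    exact (measurable_measure_prodMk_left hset).ennreal_toReal
  have hq0 : ∀ n x, 0 ≤ q n x := fun n x => measureReal_nonneg
  have hq1 : ∀ n x, q n x ≤ 1 := fun n x => measureReal_le_one
  have hη := measurable_posteriorProb P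
  refine tendsto_integral_of_dominated_convergence (fun _ => (1 : ℝ))
    (fun n => (((hqm n).mul (measurable_const.sub hη)).add
      ((measurable_const.sub (hqm n)).mul hη)).aestronglyMeasurable)
    (integrable_const _) (fun n => .of_forall fun x => ?_) ?_
  · have h0 := posteriorProb_nonneg P x
    have h1 := posteriorProb_le_one P x
    have a0 := hq0 n x
    have a1 := hq1 n x
    rw [Real.norm_of_nonneg (add_nonneg (mul_nonneg a0 (by linarith)) (mul_nonneg (by linarith) h0))]
    -- The integrand's complement to 1 is qη + (1 - q)(1 - η) ≥ 0.
    nlinarith [mul_nonneg a0 h0, mul_nonneg (sub_nonneg.2 a1) (sub_nonneg.2 h1)]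
  have hf : Integrable (fun y => posteriorProb P y - 1 / 2) P.fst :=
    (integrable_posteriorProb P).sub (integrable_const _)
  -- Applied to η - 1/2 and to its negative, one for each sign.
  filter_upwards [ae_tendsto_sqrt_mul_setIntegral_closedBall P.fst hf hr_nonneg hr_zero hr_slow,
    ae_tendsto_sqrt_mul_setIntegral_closedBall P.fst hf.neg hr_nonneg hr_zero hr_slow]
    with x hpos hneg
  set t : ℕ → ℝ := fun n =>
    ∫ y in Metric.closedBall x (r n), (posteriorProb P y - 1 / 2) ∂P.fst with ht
  have hbound : ∀ n, 0 < n → t n ≠ 0 →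
      μ.real {ω | ¬ (majorityVote (r n) (trainingData X Y Z n ω) x = 1 ↔ 0 < t n)} ≤
        ((2 * (Real.sqrt n * t n)) ^ 2)⁻¹ := fun n hn h0 =>
    measureReal_majorityVote_ne_le P hX hY hZ hlaw hcoin hindep_coin hindep_sensors (r n) hn x
      rfl h0
  have hinv : ∀ {s : ℕ → ℝ}, Tendsto s atTop atTop →
      Tendsto (fun n => ((2 * s n) ^ 2)⁻¹) atTop (𝓝 0) := fun hs =>
    ((tendsto_pow_atTop two_ne_zero).comp (hs.const_mul_atTop two_pos)).inv_tendsto_atTop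
  rcases lt_trichotomy (posteriorProb P x) (1 / 2) with hlt | heq | hgt
  · have hs := hneg (by simp only [Pi.neg_apply]; linarith)
    have hs' : Tendsto (fun n : ℕ => Real.sqrt n * -t n) atTop atTop := by
      refine hs.congr fun n => ?_
      simp only [ht, Pi.neg_apply, integral_neg]
    have hqt : Tendsto (fun n => q n x) atTop (𝓝 0) := by
      refine tendsto_of_tendsto_of_tendsto_of_le_of_le' tendsto_const_nhds (hinv hs')
        (.of_forall fun n => hq0 n x) ?_
      filter_upwards [hs'.eventually_gt_atTop 0, eventually_gt_atTop 0] with n hn hn0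
      have htn : t n < 0 := by
        have := pos_of_mul_pos_right hn (Real.sqrt_nonneg _)
        linarith
      refine le_trans ?_ ((hbound n hn0 htn.ne).trans_eq (by ring))
      exact measureReal_mono fun ω hω h => absurd (h.1 hω) htn.not_gt
    rw [min_eq_left (by linarith)]
    have := (hqt.mul_const (1 - posteriorProb P x)).add
      ((tendsto_const_nhds.sub hqt).mul_const (posteriorProb P x) (a := (1 : ℝ) - 0))
    simpa using this
  -- At η = 1/2 the integrand is 1/2 whatever the vote.
  · rw [heq]
    refine tendsto_const_nhds.congr fun n => ?_
    norm_num
    ring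
  · have hs := hpos (by linarith)
    have hqt : Tendsto (fun n => 1 - q n x) atTop (𝓝 0) := by
      refine tendsto_of_tendsto_of_tendsto_of_le_of_le' tendsto_const_nhds (hinv hs)
        (.of_forall fun n => sub_nonneg.2 (hq1 n x)) ?_
      filter_upwards [hs.eventually_gt_atTop 0, eventually_gt_atTop 0] with n hn hn0
      have htn : 0 < t n := pos_of_mul_pos_right hn (Real.sqrt_nonneg _)
      refine le_trans ?_ (hbound n hn0 htn.ne')
      rw [← probReal_compl_eq_one_sub (measurableSet_majorityVote_eq_one hX hY hZ (r n) n x)]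
      exact measureReal_mono fun ω hω h => hω (h.2 htn)
    rw [min_eq_right (by linarith)]
    have := ((tendsto_const_nhds.sub hqt).mul_const (1 - posteriorProb P x) (a := (1 : ℝ) - 0)).add
      (hqt.mul_const (posteriorProb P x))
    simpa using this
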